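/- Let $j=\begin{pmatrix}-1&0\\0&1\end{pmatrix}$. Let $\mu$ be a positive Borel measure without atoms, finite on compact sets, giving positive mass to every nonempty open interval of $[0,\infty)$, and with $\mu([0,\ell))\to\infty$ as $\ell\to\infty$. Let $\mathfrak a\in L^\infty(\mu)$ with $\|\mathfrak a\|_\infty\le 1$ on $[0,\infty)$. Put $$A=\begin{pmatrix}1&-\overline{\mathfrak a}\\-\mathfrak a&1\end{pmatrix},\qquad B=\begin{pmatrix}0&\overline{\mathfrak a}\\-\mathfrak a&0\end{pmatrix},$$ and let $\mathfrak A(z,\ell)$ be the transfer matrix of the canonical system in Arov gauge with parameters $(\mu,\mathfrak a)$, i.e. the solution of $$\mathfrak A(z,\ell)\,j=j+\int_0^\ell \mathfrak A(z,l)\,\bigl(izA(l)-B(l)\bigr)\,d\mu(l),\qquad z\in\mathbb C,\ \ell\ge 0.$$ For $\ell\ge0$ let $\mathfrak A^{[\ell]}(z,l)=\mathfrak A(z,\ell)^{-1}\mathfrak A(z,l+\ell)$ be the coefficient-stripped transfer matrix, and for $z\in\mathbb C_+=\{\operatorname{Im}z>0\}$, $l>0$, let $$D^{[\ell]}(z,l)=\Bigl\{w\in\mathbb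 C:\ \begin{pmatrix}w&1\end{pmatrix}\mathfrak A^{[\ell]}(z,l)\,j\,\mathfrak A^{[\ell]}(z,l)^*\begin{pmatrix}w&1\end{pmatrix}^*\ge0\Bigr\}$$ be its Weyl disks. Then for every $\ell\ge 0$ and $z\in\mathbb C_+$ the intersection $\bigcap_{l>0}D^{[\ell]}(z,l)$ is a single point, denoted $s_+(z,\ell)$ (so $s_+(\cdot,\ell)$ is the Schur function of the system stripped by length $\ell$), and for $\mu$-a.e. $\ell>0$ the function $s_+(\cdot,\ell)$ has the nontangential boundary value $$\lim_{\substack{z\to\infty\\ \arg z\in[\delta,\pi-\delta]}}s_+(z,\ell)=\frac{\mathfrak a(\ell)}{1+\sqrt{1-|\mathfrak a(\ell)|^2}}\qquad\text{for all }\delta>0 .$$ Consequently these boundary values determine $\mathfrak a$: for $\mu$-a.e. $\ell>0$, if $\mathfrak c(\ell)$ denotes the nontangential limit of $s_+(\cdot,\ell)$ at $\infty$, then $$\mathfrak a(\ell)=\frac{2\,\mathfrak c(\ell)}{1+|\mathfrak c(\ell)|^2}.$$ -/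

import Mathlib

open scoped Matrix Topology
open MeasureTheory Filter Set

namespace ArovGauge

/-- The signature matrix `j = diag(-1, 1)`. -/
def j : Matrix (Fin 2) (Fin 2) ℂ := !![-1, 0; 0, 1]

/-- The coefficient `A` of a canonical system in Arov gauge, as a function of the value of the
parameter `𝔞`. -/
def coeffA (a : ℂ) : Matrix (Fin 2) (Fin 2) ℂ := !![1, -star a; -a, 1]

/-- The coefficient `B` of a canonical system in Arov gauge, as a function of the value of the
parameter `𝔞`. -/
def coeffB (a : ℂ) : Matrix (Fin 2) (Fin 2) ℂ := !![0, star a; -a, 0]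

/-- `(μ, 𝔞)` are parameters of a half-line canonical system in Arov gauge: `μ` is a continuous
(atomless) measure finite on compacts, and `𝔞` lies in the closed unit ball of `L^∞(μ)` on
`[0, ∞)`. A measure on the half-line is regarded as a measure on `ℝ`; its restriction to `(-∞, 0)`
plays no role. -/
structure IsParameters (μ : Measure ℝ) (𝔞 : ℝ → ℂ) : Prop where
  locallyFinite : IsLocallyFiniteMeasure μ
  noAtoms : NullSingletonClass μ
  aestronglyMeasurable : AEStronglyMeasurable 𝔞 (μ.restrict (Ici 0))
  norm_le_one : ∀ᵐ l ∂(μ.restrict (Ici 0)), ‖𝔞 l‖ ≤ 1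

/-- The integrand `𝔄(z, l) (i z A(l) - B(l))` of the canonical system. -/
noncomputable def integrand (𝔞 : ℝ → ℂ) (𝔄 : ℂ → ℝ → Matrix (Fin 2) (Fin 2) ℂ) (z : ℂ) (l : ℝ) :
    Matrix (Fin 2) (Fin 2) ℂ :=
  𝔄 z l * ((Complex.I * z) • coeffA (𝔞 l) - coeffB (𝔞 l))

/-- `𝔄` is the transfer matrix, i.e. the solution on `[0, ∞)`, of the canonical system with
parameters `(μ, 𝔞)`:
`𝔄(z, ℓ) j = j + ∫_0^ℓ 𝔄(z, l) (i z A(l) - B(l)) dμ(l)` for all `z ∈ ℂ` and `ℓ ≥ 0`,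
where the integral of a matrix function is taken entry by entry. -/
def IsTransferMatrix (μ : Measure ℝ) (𝔞 : ℝ → ℂ) (𝔄 : ℂ → ℝ → Matrix (Fin 2) (Fin 2) ℂ) : Prop :=
  ∀ (z : ℂ) (ℓ : ℝ), 0 ≤ ℓ → ∀ p q : Fin 2,
    IntervalIntegrable (fun l => integrand 𝔞 𝔄 z l p q) μ 0 ℓ ∧
      (𝔄 z ℓ * j) p q = j p q + ∫ l in (0 : ℝ)..ℓ, integrand 𝔞 𝔄 z l p q ∂μ

/-- The Weyl disk `{w | (w 1) T j T^* (w 1)^* ≥ 0}` of a matrix `T`. The number in question is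
real, since `T j T^*` is Hermitian. -/
def weylDisk (T : Matrix (Fin 2) (Fin 2) ℂ) : Set ℂ :=
  {w | 0 ≤ ((![w, 1] ᵥ* (T * j * Tᴴ)) ⬝ᵥ star ![w, 1]).re}

/-- The intersection `⋂_{l > 0} D(z, l)` of the nested Weyl disks of a family of matrices. -/
def weylLimit (𝔄 : ℂ → ℝ → Matrix (Fin 2) (Fin 2) ℂ) (z : ℂ) : Set ℂ :=
  ⋂ l ∈ Ioi (0 : ℝ), weylDisk (𝔄 z l)

/-- Coefficient stripping by length `ℓ`:
`{𝔄(z, l)}_{l ≥ 0} ↦ {𝔄(z, ℓ)⁻¹ 𝔄(z, l + ℓ)}_{l ≥ 0}`. -/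
noncomputable def strip (𝔄 : ℂ → ℝ → Matrix (Fin 2) (Fin 2) ℂ) (ℓ : ℝ) :
    ℂ → ℝ → Matrix (Fin 2) (Fin 2) ℂ :=
  fun z l => (𝔄 z ℓ)⁻¹ * 𝔄 z (l + ℓ)

/-- The Schur function `s_+(z)` of a family of matrices: the point of `⋂_{l > 0} D(z, l)`
(meaningful when this intersection is a single point, which is the limit point case). -/
noncomputable def schur (𝔄 : ℂ → ℝ → Matrix (Fin 2) (Fin 2) ℂ) (z : ℂ) : ℂ :=
  Classical.epsilon fun w => w ∈ weylLimit 𝔄 z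

/-- The Schur functions `s_+(z, ℓ)` of the coefficient stripped families. -/
noncomputable def schurFlow (𝔄 : ℂ → ℝ → Matrix (Fin 2) (Fin 2) ℂ) (z : ℂ) (ℓ : ℝ) : ℂ :=
  schur (strip 𝔄 ℓ) z

/-- `f(z) → c` as `z → ∞` nontangentially in the upper half-plane: for every `δ > 0`,
`f(z) → c` as `z → ∞` with `arg z ∈ [δ, π - δ]`. -/
def HasNontangentialLimitAtInfty (f : ℂ → ℂ) (c : ℂ) : Prop :=
  ∀ δ : ℝ, 0 < δ →
    Tendsto f (Bornology.cobounded ℂ ⊓ 𝓟 {z : ℂ | z.arg ∈ Icc δ (Real.pi - δ)}) (𝓝 c)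

end ArovGauge

/-! Since `μ` has no atoms, charges every interval and has infinite mass, its distribution function
is a homeomorphism of the half-line. In that variable `μ` becomes Lebesgue measure, and the stripped
Weyl disks are only relabelled. It remains to study absolutely continuous row solutions (u, v) of
(u, v)' = (u, v)(izA - B)j. A point w lies in the Weyl disk of length t exactly when the solution
starting at (w, 1) has Q = |v|² - |u|² ≥ 0 at t. Moreover Q' = -2 Im z · E with E = (u, v)A(u, v)^*
≥ 0, so the disks are nested.

Limit point (`IsRowSolution.det_eq_zero`): the B-term makes N = |u|² + |v|² decrease. For a suitable
constant C, (N + CQ)' ≤ -N as long as Q ≥ 0. Adding this for two solutions with Q ≥ 0 throughout,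
and using that N + N' dominates twice the modulus of their constant Wronskian, gives a nonnegative
quantity decreasing at least linearly unless the Wronskian vanishes.

Boundary value (`IsRowSolution.im_mul_normSq_sub_le`): let b be the value of the parameter at a
right Lebesgue point, and let |w| ≤ 1 solve b(1 + |w|²) = 2w. Follow the solution from (s, 1), where
s is the Schur function. Its total energy satisfies 2 Im z ∫ E ≤ Q(0) ≤ 1. With the parameter frozen
at b, E is at least |p|²/2 for p = u - wv. Up to small errors |p| does not decrease, because (1,
-w)ᵀ is an eigenvector of izAj whose eigenvalue has real part ≥ 0. Hence Im z · τ |s - w|² ≤ 1 +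
errors. On the scale τ = t/|z| in a sector this reads |s - w|² ≤ 1/(ct) + o(1); take t large first,
then z to infinity. -/

namespace ArovGauge

/-! ### Calculus of absolutely continuous functions on the half-line -/

/-- `f` is absolutely continuous on compact subintervals of `[0, ∞)` and has derivative `f'`
almost everywhere there. -/
structure HasACDeriv {E : Type*} [NormedAddCommGroup E] [NormedSpace ℝ E] (f f' : ℝ → E) :
    Prop where
  ac : ∀ R : ℝ, 0 ≤ R → AbsolutelyContinuousOnInterval f 0 R
  deriv : ∀ᵐ t ∂(volume.restrict (Ioi (0 : ℝ))), HasDerivAt f (f' t) t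

theorem absolutelyContinuousOnInterval_const {E : Type*} [NormedAddCommGroup E] (c : E)
    (a b : ℝ) : AbsolutelyContinuousOnInterval (fun _ : ℝ => c) a b :=
  ((LipschitzWith.const c).lipschitzOnWith).absolutelyContinuousOnInterval

theorem absolutelyContinuousOnInterval_of_dist_le {X Y : Type*} [PseudoMetricSpace X]
    [PseudoMetricSpace Y] {f : ℝ → X} {g : ℝ → Y} {a b : ℝ}
    (hf : AbsolutelyContinuousOnInterval f a b) (h : ∀ s t, dist (g s) (g t) ≤ dist (f s) (f t)) :
    AbsolutelyContinuousOnInterval g a b :=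
  squeeze_zero (fun _ => Finset.sum_nonneg fun _ _ => dist_nonneg)
    (fun _ => Finset.sum_le_sum fun _ _ => h _ _) hf

namespace HasACDeriv

section General

variable {E : Type*} [NormedAddCommGroup E] [NormedSpace ℝ E] {f g f' g' : ℝ → E}

theorem congr_deriv (hf : HasACDeriv f f')
    (h : ∀ᵐ t ∂(volume.restrict (Ioi (0 : ℝ))), f' t = g' t) : HasACDeriv f g' :=
  ⟨hf.ac, by filter_upwards [hf.deriv, h] with t ht h; rwa [← h]⟩

theorem const (c : E) : HasACDeriv (fun _ => c) (fun _ => 0) :=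
  ⟨fun R _ => absolutelyContinuousOnInterval_const c 0 R,
    Eventually.of_forall fun t => hasDerivAt_const t c⟩

theorem add (hf : HasACDeriv f f') (hg : HasACDeriv g g') :
    HasACDeriv (fun t => f t + g t) (fun t => f' t + g' t) :=
  ⟨fun R hR => (hf.ac R hR).add (hg.ac R hR), by
    filter_upwards [hf.deriv, hg.deriv] with t h1 h2 using h1.add h2⟩

theorem sub (hf : HasACDeriv f f') (hg : HasACDeriv g g') :
    HasACDeriv (fun t => f t - g t) (fun t => f' t - g' t) :=
  ⟨fun R hR => (hf.ac R hR).sub (hg.ac R hR), by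
    filter_upwards [hf.deriv, hg.deriv] with t h1 h2 using h1.sub h2⟩

theorem comp_add_const (hf : HasACDeriv f f') {s : ℝ} (hs : 0 ≤ s) :
    HasACDeriv (fun t => f (t + s)) (fun t => f' (t + s)) := by
  constructor
  · intro R hR
    have h := hf.ac (R + s) (by linarith)
    rw [absolutelyContinuousOnInterval_iff] at h ⊢
    intro ε hε
    obtain ⟨δ, hδ, H⟩ := h ε hε
    refine ⟨δ, hδ, fun I hI hlt => ?_⟩
    have := H (I.1, fun i => ((I.2 i).1 + s, (I.2 i).2 + s)) ?_ (by simpa using hlt)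
    · exact this
    · obtain ⟨h1, h2⟩ := hI
      refine ⟨fun i hi => ?_, fun i hi k hk hik => ?_⟩
      · have := h1 i hi
        rw [uIcc_of_le hR] at this
        rw [uIcc_of_le (by linarith)]
        simp only [mem_Icc] at this ⊢
        constructor <;> constructor <;> linarith [this.1.1, this.1.2, this.2.1, this.2.2]
      · have := h2 hi hk hik
        simp only [Function.onFun, Set.disjoint_left, mem_uIoc] at this ⊢
        intro x hx hx'
        refine this (a := x - s) ?_ ?_
        · rcases hx with hx | hx
          · left; constructor <;> linarith [hx.1, hx.2]
          · right; constructor <;> linarith [hx.1, hx.2]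
        · rcases hx' with hx | hx
          · left; constructor <;> linarith [hx.1, hx.2]
          · right; constructor <;> linarith [hx.1, hx.2]
  · have h := hf.deriv
    rw [ae_restrict_iff' measurableSet_Ioi] at h ⊢
    have h2 := (measurePreserving_add_right (volume : Measure ℝ) s).quasiMeasurePreserving.ae h
    filter_upwards [h2] with t ht ht0
    exact (ht (by simp only [mem_Ioi] at *; linarith)).comp_add_const t s

theorem eq_of_deriv_eq_zero (hf : HasACDeriv f f')
    (h : ∀ᵐ t ∂(volume.restrict (Ioi (0 : ℝ))), f' t = 0) {R : ℝ} (hR : 0 ≤ R) : f R = f 0 := by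
  have h1 := (hf.congr_deriv (g' := fun _ => 0) h).deriv
  rw [restrict_Ioi_eq_restrict_Ici, ae_restrict_iff' measurableSet_Ici] at h1
  obtain ⟨C, hC⟩ := (hf.ac R hR).const_of_ae_hasDerivAt_zero (by
    filter_upwards [h1] with t ht ht'
    rw [uIcc_of_le hR] at ht'
    exact ht ht'.1)
  rw [hC R right_mem_uIcc, hC 0 left_mem_uIcc]

end General

theorem mul {𝕜 : Type*} [NormedField 𝕜] [NormedAlgebra ℝ 𝕜] {f g f' g' : ℝ → 𝕜}
    (hf : HasACDeriv f f') (hg : HasACDeriv g g') :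
    HasACDeriv (fun t => f t * g t) (fun t => f' t * g t + f t * g' t) :=
  ⟨fun R hR => (hf.ac R hR).smul (hg.ac R hR), by
    filter_upwards [hf.deriv, hg.deriv] with t h1 h2 using h1.mul h2⟩

theorem const_mul {𝕜 : Type*} [NormedField 𝕜] [NormedAlgebra ℝ 𝕜] {f f' : ℝ → 𝕜} (c : 𝕜)
    (hf : HasACDeriv f f') : HasACDeriv (fun t => c * f t) (fun t => c * f' t) := by
  simpa using (const c).mul hf

theorem re {f f' : ℝ → ℂ} (hf : HasACDeriv f f') :
    HasACDeriv (fun t => (f t).re) (fun t => (f' t).re) :=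
  ⟨fun R hR => absolutelyContinuousOnInterval_of_dist_le (hf.ac R hR) fun s t => by
      simpa [Real.dist_eq, Complex.dist_eq] using Complex.abs_re_le_norm (f s - f t), by
    filter_upwards [hf.deriv] with t h
    exact (Complex.reCLM.hasFDerivAt.comp_hasDerivAt t h)⟩

theorem star {f f' : ℝ → ℂ} (hf : HasACDeriv f f') :
    HasACDeriv (fun t => star (f t)) (fun t => star (f' t)) :=
  ⟨fun R hR => absolutelyContinuousOnInterval_of_dist_le (hf.ac R hR) fun s t => by simp, by
    filter_upwards [hf.deriv] with t h using h.star⟩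

theorem normSq {f f' : ℝ → ℂ} (hf : HasACDeriv f f') :
    HasACDeriv (fun t => Complex.normSq (f t)) (fun t => 2 * (f' t * Star.star (f t)).re) := by
  convert (hf.mul hf.star).re using 2 with t t
  · simp [Complex.normSq_apply]
  · simp; ring

/-- The fundamental theorem of calculus for absolutely continuous functions. Every differential
inequality below is integrated through it. -/
theorem le_of_deriv_nonpos {f f' : ℝ → ℝ} (hf : HasACDeriv f f') {s t : ℝ} (hs : 0 ≤ s)
    (hst : s ≤ t)
    (h : ∀ᵐ x ∂(volume.restrict (Ioi (0 : ℝ))), x ∈ Ioc s t → f' x ≤ 0) : f t ≤ f s := by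
  have h1 : AbsolutelyContinuousOnInterval f s t := (hf.ac t (hs.trans hst)).mono (by
    rw [uIcc_of_le hst, uIcc_of_le (hs.trans hst)]; exact Icc_subset_Icc_left hs)
  have h2 := h1.integral_deriv_eq_sub
  have h3 : ∫ x in s..t, _root_.deriv f x ≤ 0 := by
    rw [intervalIntegral.integral_of_le hst]
    refine integral_nonpos_of_ae ?_
    have h4 := ae_restrict_of_ae_restrict_of_subset (s := Ioc s t) (t := Ioi 0)
      (fun x hx => lt_of_le_of_lt hs hx.1) (hf.deriv.and h)
    filter_upwards [h4, ae_restrict_mem measurableSet_Ioc] with x hx hx'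
    rw [hx.1.deriv]; exact hx.2 hx'
  linarith

theorem of_eqOn_integral {f g : ℝ → ℂ} {c : ℂ}
    (hg : ∀ R : ℝ, 0 ≤ R → IntervalIntegrable g volume 0 R)
    (hf : ∀ R : ℝ, 0 ≤ R → f R = c + ∫ t in (0 : ℝ)..R, g t) : HasACDeriv f g := by
  have hre : ∀ R : ℝ, 0 ≤ R → IntervalIntegrable (fun t => (g t).re) volume 0 R := fun R hR =>
    ⟨(hg R hR).1.re, (hg R hR).2.re⟩
  have him : ∀ R : ℝ, 0 ≤ R → IntervalIntegrable (fun t => (g t).im) volume 0 R := fun R hR =>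
    ⟨(hg R hR).1.im, (hg R hR).2.im⟩
  constructor
  · intro R hR
    have h1 := ((hre R hR).absolutelyContinuousOnInterval_intervalIntegral (c := 0)
      left_mem_uIcc).smul (absolutelyContinuousOnInterval_const (1 : ℂ) 0 R)
    have h2 := ((him R hR).absolutelyContinuousOnInterval_intervalIntegral (c := 0)
      left_mem_uIcc).smul (absolutelyContinuousOnInterval_const Complex.I 0 R)
    have h3 := (absolutelyContinuousOnInterval_const c 0 R).add (h1.add h2)
    rw [absolutelyContinuousOnInterval_iff] at h3 ⊢
    intro ε hε
    obtain ⟨δ, hδ, H⟩ := h3 ε hε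
    refine ⟨δ, hδ, fun I hI hlt => ?_⟩
    refine (Finset.sum_congr rfl fun i hi => ?_).trans_lt (H I hI hlt)
    -- `f` is a primitive on [0, ∞) only, so it is replaced by real and imaginary primitives at the
    -- endpoints that occur in the sums.
    have key : ∀ x ∈ uIcc 0 R, f x = c + ((∫ v in (0 : ℝ)..x, (g v).re) • (1 : ℂ) +
        (∫ v in (0 : ℝ)..x, (g v).im) • Complex.I) := by
      intro x hx
      rw [uIcc_of_le hR] at hx
      rw [hf x hx.1]
      simp only [Complex.real_smul, mul_one]
      congr 1
      have e1 : ∫ v in (0:ℝ)..x, (g v).re = (∫ v in (0:ℝ)..x, g v).re := by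
        have := Complex.reCLM.intervalIntegral_comp_comm (hg x hx.1)
        simpa using this
      have e2 : ∫ v in (0:ℝ)..x, (g v).im = (∫ v in (0:ℝ)..x, g v).im := by
        have := Complex.imCLM.intervalIntegral_comp_comm (hg x hx.1)
        simpa using this
      rw [e1, e2, Complex.re_add_im]
    rw [key _ (hI.1 i hi).1, key _ (hI.1 i hi).2]
    rfl
  · have h1 : ∀ n : ℕ, ∀ᵐ x, x ∈ uIcc (0:ℝ) n → ∀ c ∈ uIcc (0:ℝ) n,
        HasDerivAt (fun x => ∫ t in c..x, g t) (g x) x := fun n =>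
      (hg n n.cast_nonneg).ae_hasDerivAt_integral
    rw [ae_restrict_iff' measurableSet_Ioi]
    filter_upwards [ae_all_iff.2 h1] with t ht ht0
    obtain ⟨n, hn⟩ := exists_nat_ge t
    have h2 := ht n (by rw [uIcc_of_le n.cast_nonneg]; exact ⟨(mem_Ioi.1 ht0).le, hn⟩) 0
      left_mem_uIcc
    refine (h2.const_add c).congr_of_eventuallyEq ?_
    filter_upwards [Ioi_mem_nhds ht0] with x hx using hf x (mem_Ioi.1 hx).le

theorem of_hasDerivAt {f f' : ℝ → ℝ} (h : ∀ t, HasDerivAt f (f' t) t) (hc : Continuous f') :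
    HasACDeriv f f' := by
  refine ⟨fun R _ => ?_, Eventually.of_forall h⟩
  refine ContDiffOn.absolutelyContinuousOnInterval ?_
  have : ContDiff ℝ 1 f := by
    rw [contDiff_one_iff_deriv]
    refine ⟨fun t => (h t).differentiableAt, ?_⟩
    rwa [show _root_.deriv f = f' from funext fun t => (h t).deriv]
  exact this.contDiffOn

end HasACDeriv

/-! ### Row solutions: pointwise inequalities -/

/-- `(u, v)` is a row solution `(u, v)' = (u, v) (i z A - B) j` of the canonical system with
parameters `(Lebesgue measure, a)` on `[0, ∞)`. -/
structure IsRowSolution (a : ℝ → ℂ) (z : ℂ) (u v : ℝ → ℂ) : Prop where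
  fst : HasACDeriv u fun t => -(Complex.I * z) * u t + (Complex.I * z - 1) * a t * v t
  snd : HasACDeriv v fun t => -(Complex.I * z + 1) * star (a t) * u t + Complex.I * z * v t

/-- The quadratic form `(u, v) A (u, v)^*`. -/
noncomputable def energy (a u v : ℂ) : ℝ :=
  Complex.normSq u + Complex.normSq v - 2 * (a * v * star u).re

theorem norm_re_mul_le (a u v : ℂ) :
    2 * |(a * v * star u).re| ≤ ‖a‖ * (Complex.normSq u + Complex.normSq v) := by
  have h1 : |(a * v * star u).re| ≤ ‖a‖ * (‖v‖ * ‖u‖) := by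
    refine (Complex.abs_re_le_norm _).trans ?_
    rw [norm_mul, norm_mul, norm_star, mul_assoc]
  rw [Complex.normSq_eq_norm_sq, Complex.normSq_eq_norm_sq]
  nlinarith [mul_nonneg (norm_nonneg a) (sq_nonneg (‖u‖ - ‖v‖))]

theorem energy_nonneg {a u v : ℂ} (ha : ‖a‖ ≤ 1) : 0 ≤ energy a u v := by
  have h1 := norm_re_mul_le a u v
  have h2 := le_abs_self (a * v * star u).re
  have h3 := Complex.normSq_nonneg u
  have h4 := Complex.normSq_nonneg v
  unfold energy
  nlinarith

theorem energy_sub_le (a b u v : ℂ) :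
    energy b u v - ‖a - b‖ * (Complex.normSq u + Complex.normSq v) ≤ energy a u v := by
  have h1 := norm_re_mul_le (a - b) u v
  have h2 := le_abs_self ((a - b) * v * star u).re
  have h3 : ((a - b) * v * star u).re = (a * v * star u).re - (b * v * star u).re := by
    rw [← Complex.sub_re]; ring_nf
  unfold energy
  linarith

/-- The relation between b and w turns (1 + |w|²)E into the sum of squares |u - wv|² + |v - w̄u|²,
and 1 + |w|² ≤ 2. -/
theorem normSq_sub_mul_le_energy {b w u v : ℂ} (hw : Complex.normSq w ≤ 1)
    (hb : b * (1 + Complex.normSq w) = 2 * w) :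
    Complex.normSq (u - w * v) ≤ 2 * energy b u v := by
  have hb1 : ‖b‖ ≤ 1 := by
    have h := congrArg norm hb
    have h1 : ‖(1 + Complex.normSq w : ℂ)‖ = 1 + ‖w‖ ^ 2 := by
      rw [Complex.normSq_eq_norm_sq, ← Complex.ofReal_one, ← Complex.ofReal_add,
        Complex.norm_real, Real.norm_of_nonneg (by positivity)]
    rw [norm_mul, norm_mul, h1, Complex.norm_ofNat] at h
    by_contra hc
    nlinarith [sq_nonneg (‖w‖ - 1), norm_nonneg w]
  have h0 : 0 ≤ energy b u v := energy_nonneg hb1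
  have key : (1 + Complex.normSq w) * energy b u v =
      Complex.normSq (u - w * v) + Complex.normSq (v - star w * u) := by
    have h1 : (1 + Complex.normSq w) * (b * v * star u).re = (2 * w * v * star u).re := by
      rw [← hb, ← Complex.re_ofReal_mul]; push_cast; ring_nf
    unfold energy
    rw [mul_sub, mul_left_comm, h1]
    simp [Complex.normSq_apply]
    ring
  nlinarith [Complex.normSq_nonneg (v - star w * u)]

theorem two_mul_norm_det_le (u v u' v' : ℂ) :
    2 * ‖u * v' - v * u'‖ ≤ Complex.normSq u + Complex.normSq v +
      (Complex.normSq u' + Complex.normSq v') := by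
  have h1 : ‖u * v' - v * u'‖ ≤ ‖u‖ * ‖v'‖ + ‖v‖ * ‖u'‖ := by
    refine (norm_sub_le _ _).trans ?_
    rw [norm_mul, norm_mul]
  simp only [Complex.normSq_eq_norm_sq]
  nlinarith [sq_nonneg (‖u‖ - ‖v'‖), sq_nonneg (‖v‖ - ‖u'‖)]

theorem deriv_normSq_add_eq (a z u v : ℂ) :
    2 * ((-(Complex.I * z) * u + (Complex.I * z - 1) * a * v) * star u).re +
      2 * ((-(Complex.I * z + 1) * star a * u + Complex.I * z * v) * star v).re =
    -(2 * z.im * (Complex.normSq v - Complex.normSq u)) - 4 * z.re * (a * v * star u).im -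
      4 * (a * v * star u).re := by
  simp [Complex.normSq_apply]
  ring

/-- Since 2 Re(a v ū) = N - E, the term contributed by B equals -2N + 2E. One of the two copies of
-N is spent on absorbing the term with Re z, and the other gives the decay. -/
theorem deriv_normSq_add_le {a z u v : ℂ} (ha : ‖a‖ ≤ 1) :
    2 * ((-(Complex.I * z) * u + (Complex.I * z - 1) * a * v) * star u).re +
      2 * ((-(Complex.I * z + 1) * star a * u + Complex.I * z * v) * star v).re ≤
    -(Complex.normSq u + Complex.normSq v) + (2 + 2 * z.re ^ 2) * energy a u v -
      2 * z.im * (Complex.normSq v - Complex.normSq u) := by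
  rw [deriv_normSq_add_eq]
  have hE := energy_nonneg (u := u) (v := v) ha
  have hc : (a * v * star u).re ^ 2 + (a * v * star u).im ^ 2 ≤
      (Complex.normSq u + Complex.normSq v) ^ 2 / 4 := by
    have h1 : (a * v * star u).re ^ 2 + (a * v * star u).im ^ 2 =
        ‖a‖ ^ 2 * (Complex.normSq v * Complex.normSq u) := by
      rw [← Complex.normSq_eq_norm_sq]
      simp [Complex.normSq_apply]; ring
    rw [h1]
    have h2 : ‖a‖ ^ 2 ≤ 1 := pow_le_one₀ (norm_nonneg a) ha
    nlinarith [mul_nonneg (Complex.normSq_nonneg v) (Complex.normSq_nonneg u),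
      sq_nonneg (Complex.normSq v - Complex.normSq u)]
  have hre : (a * v * star u).re = (Complex.normSq u + Complex.normSq v - energy a u v) / 2 := by
    unfold energy; ring
  have hN : 0 ≤ Complex.normSq u + Complex.normSq v :=
    add_nonneg (Complex.normSq_nonneg u) (Complex.normSq_nonneg v)
  rw [hre] at hc ⊢
  generalize Complex.normSq u + Complex.normSq v = N at *
  generalize energy a u v = E at *
  generalize (a * v * star u).im = c at *
  -- The bound `hc` says 4c² ≤ E(2N - E), so (4xc)² ≤ 8x²NE ≤ (N + 2x²E)² with x = Re z.
  have h4 : -(4 * z.re * c) ≤ N + 2 * z.re ^ 2 * E := by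
    refine le_of_abs_le (abs_le_of_sq_le_sq ?_ (by positivity))
    nlinarith [sq_nonneg (N - 2 * z.re ^ 2 * E), mul_nonneg (sq_nonneg z.re) (sub_nonneg.2 hc),
      mul_nonneg (sq_nonneg z.re) (sq_nonneg E)]
  nlinarith

theorem deriv_normSq_add_le_mul {a z u v : ℂ} (ha : ‖a‖ ≤ 1) (hz : 1 ≤ ‖z‖) :
    2 * ((-(Complex.I * z) * u + (Complex.I * z - 1) * a * v) * star u).re +
      2 * ((-(Complex.I * z + 1) * star a * u + Complex.I * z * v) * star v).re ≤
    6 * ‖z‖ * (Complex.normSq u + Complex.normSq v) := by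
  rw [deriv_normSq_add_eq]
  have hu := Complex.normSq_nonneg u
  have hv := Complex.normSq_nonneg v
  have hc : 2 * ‖a * v * star u‖ ≤ Complex.normSq u + Complex.normSq v := by
    rw [norm_mul, norm_mul, norm_star]
    simp only [Complex.normSq_eq_norm_sq]
    nlinarith [mul_nonneg (norm_nonneg v) (norm_nonneg u), sq_nonneg (‖u‖ - ‖v‖)]
  have h1 := Complex.abs_re_le_norm (a * v * star u)
  have h2 := Complex.abs_im_le_norm (a * v * star u)
  have h3 : -(z.re * (a * v * star u).im) ≤ ‖z‖ * ‖a * v * star u‖ := by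
    refine (neg_le_abs _).trans ?_
    rw [abs_mul]
    exact mul_le_mul (Complex.abs_re_le_norm z) h2 (abs_nonneg _) (norm_nonneg _)
  have h4 : -(z.im * (Complex.normSq v - Complex.normSq u)) ≤
      ‖z‖ * (Complex.normSq u + Complex.normSq v) := by
    refine (neg_le_abs _).trans ?_
    rw [abs_mul]
    refine mul_le_mul (Complex.abs_im_le_norm z) ?_ (abs_nonneg _) (norm_nonneg _)
    exact abs_le.2 ⟨by linarith, by linarith⟩
  have h5 := (neg_le_abs _).trans h1
  nlinarith [norm_nonneg (a * v * star u)]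

/-- For a = b and B dropped, p = u - wv satisfies p' = -izκp with κ = (1 - |w|²)/(1 + |w|²) ≥ 0, so
|p|² does not decrease in the upper half-plane. Only the deviation a - b, amplified by |z|, and the
bounded contribution of B can make it shrink. -/
theorem neg_le_deriv_normSq_sub {a b z w u v : ℂ} (ha : ‖a‖ ≤ 1) (hz : 0 ≤ z.im)
    (hw : Complex.normSq w ≤ 1) (hb : b * (1 + Complex.normSq w) = 2 * w) :
    -(4 * (‖z‖ * ‖a - b‖ + 1) * (Complex.normSq u + Complex.normSq v)) ≤
    2 * ((-(Complex.I * z) * u + (Complex.I * z - 1) * a * v -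
      w * (-(Complex.I * z + 1) * star a * u + Complex.I * z * v)) * star (u - w * v)).re := by
  have hw' : ‖w‖ ≤ 1 := by
    rw [Complex.normSq_eq_norm_sq] at hw
    nlinarith [norm_nonneg w]
  have hpos : (0 : ℝ) < 1 + Complex.normSq w := by linarith [Complex.normSq_nonneg w]
  have hne : (1 + Complex.normSq w : ℂ) ≠ 0 := by exact_mod_cast hpos.ne'
  obtain ⟨κ, hκ, hκe⟩ : ∃ κ : ℝ, 0 ≤ κ ∧ κ = (1 - Complex.normSq w) / (1 + Complex.normSq w) :=
    ⟨_, div_nonneg (by linarith) hpos.le, rfl⟩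
  have hb' : b = 2 * w / (1 + Complex.normSq w) := by rw [← hb]; field_simp
  have hns : star w * w = Complex.normSq w := by
    rw [mul_comm]; exact Complex.mul_conj w
  have e1 : b = w + κ * w := by
    rw [hb', hκe]; push_cast; field_simp; ring
  have e2 : star b * w = 1 - κ := by
    have : star b = star w + κ * star w := by rw [e1]; simp
    rw [this, hκe]; push_cast
    field_simp
    linear_combination 2 * hns
  -- The remainder collects the terms with a - b, which carry the factor z, and the terms of B,
  -- which do not.
  set r : ℂ := Complex.I * z * (a - b) * v + w * (Complex.I * z) * star (a - b) * u - a * v +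
    w * star a * u with hr
  have hsplit : -(Complex.I * z) * u + (Complex.I * z - 1) * a * v -
      w * (-(Complex.I * z + 1) * star a * u + Complex.I * z * v) =
      -(Complex.I * z) * κ * (u - w * v) + r := by
    rw [hr, star_sub]
    linear_combination (Complex.I * z * v) * e1 + (Complex.I * z * u) * e2
  have hrn : ‖r‖ ≤ (‖z‖ * ‖a - b‖ + 1) * (‖u‖ + ‖v‖) := by
    have t1 : ‖Complex.I * z * (a - b) * v‖ ≤ ‖z‖ * ‖a - b‖ * ‖v‖ := by simp
    have t2 : ‖w * (Complex.I * z) * star (a - b) * u‖ ≤ ‖z‖ * ‖a - b‖ * ‖u‖ := by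
      rw [norm_mul, norm_mul, norm_mul, norm_mul, norm_star, Complex.norm_I, one_mul]
      have := mul_nonneg (mul_nonneg (norm_nonneg z) (norm_nonneg (a - b))) (norm_nonneg u)
      nlinarith
    have t3 : ‖a * v‖ ≤ ‖v‖ := by rw [norm_mul]; nlinarith [norm_nonneg v]
    have t4 : ‖w * star a * u‖ ≤ ‖u‖ := by
      rw [norm_mul, norm_mul, norm_star]
      have : ‖w‖ * ‖a‖ ≤ 1 := mul_le_one₀ hw' (norm_nonneg a) ha
      nlinarith [norm_nonneg u]
    calc ‖r‖ ≤ ‖Complex.I * z * (a - b) * v‖ + ‖w * (Complex.I * z) * star (a - b) * u‖ +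
        ‖a * v‖ + ‖w * star a * u‖ := by
          refine (norm_add_le _ _).trans (add_le_add_left ?_ _)
          refine (norm_sub_le _ _).trans (add_le_add_left ?_ _)
          exact norm_add_le _ _
      _ ≤ _ := by linarith
  have hpn : ‖u - w * v‖ ≤ ‖u‖ + ‖v‖ := by
    refine (norm_sub_le _ _).trans ?_
    rw [norm_mul]
    nlinarith [norm_nonneg v]
  have hmain : ((-(Complex.I * z) * κ * (u - w * v) + r) * star (u - w * v)).re =
      z.im * κ * Complex.normSq (u - w * v) + (r * star (u - w * v)).re := by
    generalize u - w * v = p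
    rw [add_mul, Complex.add_re]
    congr 1
    simp [Complex.normSq_apply]
    ring
  rw [hsplit, hmain]
  have h1 : -((‖z‖ * ‖a - b‖ + 1) * (‖u‖ + ‖v‖) ^ 2) ≤ (r * star (u - w * v)).re := by
    have h2 := (Complex.abs_re_le_norm (r * star (u - w * v)))
    rw [norm_mul, norm_star] at h2
    have h3 := neg_abs_le (r * star (u - w * v)).re
    have h4 : ‖r‖ * ‖u - w * v‖ ≤ (‖z‖ * ‖a - b‖ + 1) * (‖u‖ + ‖v‖) * (‖u‖ + ‖v‖) :=
      mul_le_mul hrn hpn (norm_nonneg _) (by positivity)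
    nlinarith
  have h5 : 0 ≤ z.im * κ * Complex.normSq (u - w * v) :=
    mul_nonneg (mul_nonneg hz hκ) (Complex.normSq_nonneg _)
  have h6 : (‖u‖ + ‖v‖) ^ 2 ≤ 2 * (Complex.normSq u + Complex.normSq v) := by
    simp only [Complex.normSq_eq_norm_sq]
    nlinarith [sq_nonneg (‖u‖ - ‖v‖)]
  have h7 : 0 ≤ ‖z‖ * ‖a - b‖ + 1 := by positivity
  nlinarith [mul_le_mul_of_nonneg_left h6 h7]

/-! ### Row solutions: Wronskian, limit point argument, comparison with a frozen parameter -/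

namespace IsRowSolution

variable {a : ℝ → ℂ} {z : ℂ} {u v u' v' : ℝ → ℂ}

theorem add (h : IsRowSolution a z u v) (h' : IsRowSolution a z u' v') :
    IsRowSolution a z (fun t => u t + u' t) (fun t => v t + v' t) :=
  ⟨(h.fst.add h'.fst).congr_deriv (Eventually.of_forall fun t => by ring),
    (h.snd.add h'.snd).congr_deriv (Eventually.of_forall fun t => by ring)⟩

theorem const_mul (c : ℂ) (h : IsRowSolution a z u v) :
    IsRowSolution a z (fun t => c * u t) (fun t => c * v t) :=
  ⟨(h.fst.const_mul c).congr_deriv (Eventually.of_forall fun t => by ring),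
    (h.snd.const_mul c).congr_deriv (Eventually.of_forall fun t => by ring)⟩

theorem comp_add_const (h : IsRowSolution a z u v) {s : ℝ} (hs : 0 ≤ s) :
    IsRowSolution (fun t => a (t + s)) z (fun t => u (t + s)) (fun t => v (t + s)) :=
  ⟨h.fst.comp_add_const hs, h.snd.comp_add_const hs⟩

/-- The matrix (izA - B)j has trace zero, so the Wronskian is constant. -/
theorem det_eq (h : IsRowSolution a z u v) (h' : IsRowSolution a z u' v') {t : ℝ} (ht : 0 ≤ t) :
    u t * v' t - v t * u' t = u 0 * v' 0 - v 0 * u' 0 :=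
  ((h.fst.mul h'.snd).sub (h.snd.mul h'.fst)).eq_of_deriv_eq_zero
    (Eventually.of_forall fun t => by ring) ht

theorem hasACDeriv_normSq_sub (h : IsRowSolution a z u v) :
    HasACDeriv (fun t => Complex.normSq (v t) - Complex.normSq (u t))
      (fun t => -(2 * z.im * energy (a t) (u t) (v t))) :=
  (h.snd.normSq.sub h.fst.normSq).congr_deriv (Eventually.of_forall fun t => by
    simp [energy, Complex.normSq_apply]
    ring)

theorem normSq_sub_antitone (h : IsRowSolution a z u v)
    (ha : ∀ᵐ t ∂(volume.restrict (Ioi (0 : ℝ))), ‖a t‖ ≤ 1) (hz : 0 ≤ z.im) {s t : ℝ}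
    (hs : 0 ≤ s) (hst : s ≤ t) :
    Complex.normSq (v t) - Complex.normSq (u t) ≤ Complex.normSq (v s) - Complex.normSq (u s) :=
  h.hasACDeriv_normSq_sub.le_of_deriv_nonpos hs hst (by
    filter_upwards [ha] with x hx _
    have := mul_nonneg hz (energy_nonneg (u := u x) (v := v x) hx)
    linarith)

/-- Two row solutions whose quadratic forms stay nonnegative in the upper half-plane are linearly
dependent. -/
theorem det_eq_zero (h : IsRowSolution a z u v) (h' : IsRowSolution a z u' v')
    (ha : ∀ᵐ t ∂(volume.restrict (Ioi (0 : ℝ))), ‖a t‖ ≤ 1) (hz : 0 < z.im)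
    (hQ : ∀ t, 0 ≤ t → 0 ≤ Complex.normSq (v t) - Complex.normSq (u t))
    (hQ' : ∀ t, 0 ≤ t → 0 ≤ Complex.normSq (v' t) - Complex.normSq (u' t)) :
    u 0 * v' 0 - v 0 * u' 0 = 0 := by
  -- Chosen so that CQ' cancels the energy term in `deriv_normSq_add_le`.
  set C : ℝ := (2 + 2 * z.re ^ 2) / (2 * z.im) with hC
  have hC0 : 0 ≤ C := by positivity
  have hCz : C * (2 * z.im) = 2 + 2 * z.re ^ 2 := by rw [hC]; field_simp
  set D : ℝ := 2 * ‖u 0 * v' 0 - v 0 * u' 0‖ with hD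
  -- The added term Dt turns the linear decrease of Φ into monotonicity of Φ + Dt.
  have hac := ((((h.fst.normSq.add h.snd.normSq).add (h.hasACDeriv_normSq_sub.const_mul C)).add
    ((h'.fst.normSq.add h'.snd.normSq).add (h'.hasACDeriv_normSq_sub.const_mul C))).add
    ((HasACDeriv.of_hasDerivAt (f' := fun _ => 1) (fun t => hasDerivAt_id t)
      continuous_const).const_mul D))
  set Φ : ℝ → ℝ := fun t => Complex.normSq (u t) + Complex.normSq (v t) +
    C * (Complex.normSq (v t) - Complex.normSq (u t)) +
    (Complex.normSq (u' t) + Complex.normSq (v' t) +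
    C * (Complex.normSq (v' t) - Complex.normSq (u' t))) with hΦ
  have key : ∀ R : ℝ, 0 ≤ R → D * R ≤ Φ 0 := by
    intro R hR
    have h1 := hac.le_of_deriv_nonpos le_rfl hR (by
      filter_upwards [ha, ae_restrict_mem measurableSet_Ioi] with t hat ht _
      have ht0 : 0 ≤ t := (mem_Ioi.1 ht).le
      have e1 := deriv_normSq_add_le (z := z) (u := u t) (v := v t) hat
      have e2 := deriv_normSq_add_le (z := z) (u := u' t) (v := v' t) hat
      have e3 := two_mul_norm_det_le (u t) (v t) (u' t) (v' t)
      rw [h.det_eq h' ht0] at e3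
      have e4 := mul_nonneg hz.le (hQ t ht0)
      have e5 := mul_nonneg hz.le (hQ' t ht0)
      have e6 : C * -(2 * z.im * energy (a t) (u t) (v t)) =
          -((2 + 2 * z.re ^ 2) * energy (a t) (u t) (v t)) := by rw [← hCz]; ring
      have e7 : C * -(2 * z.im * energy (a t) (u' t) (v' t)) =
          -((2 + 2 * z.re ^ 2) * energy (a t) (u' t) (v' t)) := by rw [← hCz]; ring
      rw [e6, e7]
      linarith)
    have h2 := mul_nonneg hC0 (hQ R hR)
    have h3 := mul_nonneg hC0 (hQ' R hR)
    have p1 := Complex.normSq_nonneg (u R)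
    have p2 := Complex.normSq_nonneg (v R)
    have p3 := Complex.normSq_nonneg (u' R)
    have p4 := Complex.normSq_nonneg (v' R)
    simp only [id, mul_zero, add_zero] at h1
    simp only [hΦ]
    linarith
  have hD0 : 0 ≤ D := by positivity
  have hΦ0 : 0 ≤ Φ 0 := by simpa using key 0 le_rfl
  have hDz : D = 0 := by
    by_contra hne
    have hDp : 0 < D := lt_of_le_of_ne hD0 (Ne.symm hne)
    have := key ((Φ 0 + 1) / D) (by positivity)
    rw [mul_div_cancel₀ _ hne] at this
    linarith
  simpa [hD] using hDz

theorem normSq_add_le (h : IsRowSolution a z u v)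
    (ha : ∀ᵐ t ∂(volume.restrict (Ioi (0 : ℝ))), ‖a t‖ ≤ 1) (hz : 1 ≤ ‖z‖) {t : ℝ} (ht : 0 ≤ t) :
    Complex.normSq (u t) + Complex.normSq (v t) ≤
      (Complex.normSq (u 0) + Complex.normSq (v 0)) * Real.exp (6 * ‖z‖ * t) := by
  have hexp : HasACDeriv (fun t : ℝ => Real.exp (-(6 * ‖z‖) * t))
      (fun t => Real.exp (-(6 * ‖z‖) * t) * -(6 * ‖z‖)) :=
    HasACDeriv.of_hasDerivAt (fun t => by
      simpa using ((hasDerivAt_id t).const_mul (-(6 * ‖z‖))).exp) (by fun_prop)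
  have h1 := ((h.fst.normSq.add h.snd.normSq).mul hexp).le_of_deriv_nonpos le_rfl ht (by
    filter_upwards [ha] with x hx _
    have e := deriv_normSq_add_le_mul (u := u x) (v := v x) hx hz
    have := Real.exp_pos (-(6 * ‖z‖) * x)
    nlinarith)
  simp only [mul_zero, Real.exp_zero, mul_one] at h1
  have h2 : Real.exp (-(6 * ‖z‖) * t) * Real.exp (6 * ‖z‖ * t) = 1 := by
    rw [← Real.exp_add]; simp
  calc _ = (Complex.normSq (u t) + Complex.normSq (v t)) * Real.exp (-(6 * ‖z‖) * t) *
      Real.exp (6 * ‖z‖ * t) := by rw [mul_assoc, h2, mul_one]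
    _ ≤ _ := mul_le_mul_of_nonneg_right h1 (Real.exp_pos _).le

/-- A quantitative comparison of a row solution with the constant coefficient system whose
parameter is `b`; here `(w, 1)` spans the decaying row solutions of that system. -/
theorem im_mul_normSq_sub_le (h : IsRowSolution a z u v)
    (ha : ∀ᵐ t ∂(volume.restrict (Ioi (0 : ℝ))), ‖a t‖ ≤ 1) (hz : 0 ≤ z.im) (hz1 : 1 ≤ ‖z‖)
    {b w : ℂ} (hw : Complex.normSq w ≤ 1) (hb : b * (1 + Complex.normSq w) = 2 * w)
    {g : ℝ → ℝ} (hg : HasACDeriv g fun t => ‖a t - b‖) (hg0 : g 0 = 0) (hv0 : v 0 = 1)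
    {τ : ℝ} (hτ : 0 ≤ τ) (hQ : 0 ≤ Complex.normSq (v τ) - Complex.normSq (u τ)) :
    z.im * τ * Complex.normSq (u 0 - w) ≤
      1 + 2 * z.im * (2 * Real.exp (6 * ‖z‖ * τ)) * g τ +
        z.im * τ * (4 * (2 * Real.exp (6 * ‖z‖ * τ)) * (‖z‖ * g τ + τ)) := by
  -- A bound for N on [0, τ]: the initial value |u(0)|² + 1 is at most 2, because Q(0) ≥ Q(τ) ≥ 0.
  set m : ℝ := 2 * Real.exp (6 * ‖z‖ * τ) with hm
  have hQ0 : Complex.normSq (u 0) ≤ 1 := by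
    have := h.normSq_sub_antitone ha hz le_rfl hτ
    rw [hv0, map_one] at this
    linarith
  have hN : ∀ t, 0 ≤ t → t ≤ τ → Complex.normSq (u t) + Complex.normSq (v t) ≤ m := by
    intro t ht htτ
    refine (h.normSq_add_le ha hz1 ht).trans ?_
    rw [hm, hv0, map_one]
    refine mul_le_mul (by linarith) (Real.exp_le_exp.2 ?_) (Real.exp_pos _).le (by norm_num)
    exact mul_le_mul_of_nonneg_left htτ (by positivity)
  have hm0 : 0 ≤ m := by positivity
  have hgmono : ∀ t, 0 ≤ t → t ≤ τ → g t ≤ g τ := by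
    intro t ht htτ
    have := (hg.const_mul (-1)).le_of_deriv_nonpos ht htτ
      (Eventually.of_forall fun x _ => by simp)
    linarith
  have hid : HasACDeriv (fun t : ℝ => t) (fun _ => 1) :=
    HasACDeriv.of_hasDerivAt (fun t => hasDerivAt_id t) continuous_const
  have hp := h.fst.sub (h.snd.const_mul w)
  have hP : ∀ t, 0 ≤ t → t ≤ τ → Complex.normSq (u 0 - w) - 4 * m * (‖z‖ * g τ + τ) ≤
      Complex.normSq (u t - w * v t) := by
    intro t ht htτ
    have h1 := ((hp.normSq.const_mul (-1)).sub
      (((hg.const_mul ‖z‖).add hid).const_mul (4 * m))).le_of_deriv_nonpos le_rfl ht (by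
        filter_upwards [ha] with x hx hxt
        have e1 := neg_le_deriv_normSq_sub (u := u x) (v := v x) hx hz hw hb
        have e2 := hN x hxt.1.le (hxt.2.trans htτ)
        have e3 : 0 ≤ ‖z‖ * ‖a x - b‖ + 1 := by positivity
        have e4 := mul_le_mul_of_nonneg_left e2 e3
        linarith)
    simp only [hg0, hv0, mul_one, mul_zero, add_zero, sub_zero] at h1
    have h2 : 4 * m * (‖z‖ * g t + t) ≤ 4 * m * (‖z‖ * g τ + τ) := by
      have := mul_le_mul_of_nonneg_left (hgmono t ht htτ) (norm_nonneg z)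
      exact mul_le_mul_of_nonneg_left (by linarith) (by positivity)
    linarith
  set K : ℝ := Complex.normSq (u 0 - w) - 4 * m * (‖z‖ * g τ + τ) with hK
  -- Q pays for the energy: 2E ≥ K - 2m|a - b| at each point, so Q + Im z · Kt - 2 Im z · m g does
  -- not increase.
  have h3 := ((h.hasACDeriv_normSq_sub.add (hid.const_mul (z.im * K))).sub
    (hg.const_mul (2 * z.im * m))).le_of_deriv_nonpos le_rfl hτ (by
      filter_upwards with x hx
      have e1 := energy_sub_le (a x) b (u x) (v x)
      have e2 := normSq_sub_mul_le_energy (u := u x) (v := v x) hw hb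
      have e3 := mul_le_mul_of_nonneg_left (hN x hx.1.le hx.2) (norm_nonneg (a x - b))
      have e4 := hP x hx.1.le hx.2
      have e5 : K ≤ 2 * energy (a x) (u x) (v x) + 2 * m * ‖a x - b‖ := by linarith
      have e6 := mul_le_mul_of_nonneg_left e5 hz
      linarith)
  simp only [hg0, hv0, map_one, mul_zero, add_zero, sub_zero] at h3
  have h4 : z.im * K * τ = z.im * τ * Complex.normSq (u 0 - w) -
      z.im * τ * (4 * m * (‖z‖ * g τ + τ)) := by rw [hK]; ring
  have h5 := Complex.normSq_nonneg (u 0)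
  linarith

end IsRowSolution

/-! ### Weyl disks and Schur functions for Lebesgue measure -/

theorem mem_weylDisk_iff {T : Matrix (Fin 2) (Fin 2) ℂ} {w : ℂ} :
    w ∈ weylDisk T ↔
      0 ≤ Complex.normSq (w * T 0 1 + T 1 1) - Complex.normSq (w * T 0 0 + T 1 0) := by
  have : ((![w, 1] ᵥ* (T * j * Tᴴ)) ⬝ᵥ star ![w, 1]).re =
      Complex.normSq (w * T 0 1 + T 1 1) - Complex.normSq (w * T 0 0 + T 1 0) := by
    simp [j, Matrix.vecMul, dotProduct, Matrix.mul_apply, Fin.sum_univ_two,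
      Complex.normSq_apply, Matrix.conjTranspose_apply]
    ring
  rw [weylDisk, mem_ofPred_eq, this]

theorem isClosed_weylDisk (T : Matrix (Fin 2) (Fin 2) ℂ) : IsClosed (weylDisk T) := by
  have : weylDisk T = {w | 0 ≤ Complex.normSq (w * T 0 1 + T 1 1) -
      Complex.normSq (w * T 0 0 + T 1 0)} := by
    ext w; exact mem_weylDisk_iff
  rw [this]
  refine isClosed_le continuous_const ?_
  exact (Complex.continuous_normSq.comp (by fun_prop)).sub
    (Complex.continuous_normSq.comp (by fun_prop))

theorem weylLimit_eq_singleton_schur {T : ℂ → ℝ → Matrix (Fin 2) (Fin 2) ℂ} {z : ℂ}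
    (h : ∃ w, weylLimit T z = {w}) : weylLimit T z = {schur T z} := by
  obtain ⟨w, hw⟩ := h
  have h1 : schur T z ∈ weylLimit T z :=
    Classical.epsilon_spec (p := fun w => w ∈ weylLimit T z) ⟨w, by rw [hw]; rfl⟩
  rw [hw, mem_singleton_iff] at h1
  rw [hw, h1]

/-- `T` is the transfer matrix of the canonical system with parameters `(Lebesgue measure, a)`. -/
structure IsLebesgueTransferMatrix (a : ℝ → ℂ) (T : ℂ → ℝ → Matrix (Fin 2) (Fin 2) ℂ) :
    Prop where
  zero : ∀ z, T z 0 = 1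
  row : ∀ z p, IsRowSolution a z (fun t => T z t p 0) (fun t => T z t p 1)

namespace IsLebesgueTransferMatrix

variable {a : ℝ → ℂ} {T : ℂ → ℝ → Matrix (Fin 2) (Fin 2) ℂ} {z : ℂ}

theorem isRowSolution (hT : IsLebesgueTransferMatrix a T) (z w : ℂ) :
    IsRowSolution a z (fun t => w * T z t 0 0 + T z t 1 0) (fun t => w * T z t 0 1 + T z t 1 1) :=
  ((hT.row z 0).const_mul w).add (hT.row z 1)

theorem det_eq_one (hT : IsLebesgueTransferMatrix a T) (z : ℂ) {t : ℝ} (ht : 0 ≤ t) :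
    (T z t).det = 1 := by
  have h := (hT.row z 0).det_eq (hT.row z 1) ht
  simp only [hT.zero] at h
  rw [Matrix.det_fin_two, h]
  simp

theorem strip (hT : IsLebesgueTransferMatrix a T) {s : ℝ} (hs : 0 ≤ s) :
    IsLebesgueTransferMatrix (fun t => a (t + s)) (strip T s) := by
  constructor
  · intro z
    simp only [ArovGauge.strip, zero_add]
    exact Matrix.nonsing_inv_mul _ (by rw [hT.det_eq_one z hs]; exact isUnit_one)
  · intro z p
    have h := (((hT.row z 0).const_mul ((T z s)⁻¹ p 0)).add
      ((hT.row z 1).const_mul ((T z s)⁻¹ p 1))).comp_add_const hs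
    simpa only [ArovGauge.strip, Matrix.mul_apply, Fin.sum_univ_two] using h

theorem weylDisk_anti (hT : IsLebesgueTransferMatrix a T)
    (ha : ∀ᵐ t ∂(volume.restrict (Ioi (0 : ℝ))), ‖a t‖ ≤ 1) (hz : 0 ≤ z.im) {s t : ℝ}
    (hs : 0 ≤ s) (hst : s ≤ t) : weylDisk (T z t) ⊆ weylDisk (T z s) := by
  intro w hw
  rw [mem_weylDisk_iff] at hw ⊢
  exact hw.trans ((hT.isRowSolution z w).normSq_sub_antitone ha hz hs hst)

theorem weylDisk_nonempty (hT : IsLebesgueTransferMatrix a T)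
    (ha : ∀ᵐ t ∂(volume.restrict (Ioi (0 : ℝ))), ‖a t‖ ≤ 1) (hz : 0 ≤ z.im) {t : ℝ}
    (ht : 0 ≤ t) : (weylDisk (T z t)).Nonempty := by
  have h := (hT.row z 0).normSq_sub_antitone ha hz le_rfl ht
  -- The first row starts at (1, 0) with Q = -1, and Q cannot increase. The witness below is the
  -- point whose row solution has first entry zero at t.
  have hne : T z t 0 0 ≠ 0 := by
    intro h0
    simp [hT.zero, h0] at h
    linarith [Complex.normSq_nonneg (T z t 0 1)]
  refine ⟨-T z t 1 0 / T z t 0 0, ?_⟩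
  rw [mem_weylDisk_iff, div_mul_cancel₀ _ hne, neg_add_cancel, map_zero, sub_zero]
  exact Complex.normSq_nonneg _

theorem weylDisk_zero (hT : IsLebesgueTransferMatrix a T) (z : ℂ) :
    weylDisk (T z 0) = Metric.closedBall 0 1 := by
  ext w
  rw [mem_weylDisk_iff, hT.zero]
  simp [Complex.normSq_eq_norm_sq]

theorem mem_weylLimit (hT : IsLebesgueTransferMatrix a T)
    (ha : ∀ᵐ t ∂(volume.restrict (Ioi (0 : ℝ))), ‖a t‖ ≤ 1) (hz : 0 ≤ z.im) {w : ℂ}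
    (hw : w ∈ weylLimit T z) {t : ℝ} (ht : 0 ≤ t) :
    0 ≤ Complex.normSq (w * T z t 0 1 + T z t 1 1) -
      Complex.normSq (w * T z t 0 0 + T z t 1 0) := by
  rw [← mem_weylDisk_iff]
  -- The intersection runs over positive lengths only, so t = 0 is reached by nesting from length t
  -- + 1.
  refine hT.weylDisk_anti ha hz ht (le_add_of_nonneg_right zero_le_one) ?_
  exact mem_iInter₂.1 hw (t + 1) (by simp only [mem_Ioi]; linarith)

/-- The limit point property. -/
theorem weylLimit_eq (hT : IsLebesgueTransferMatrix a T)
    (ha : ∀ᵐ t ∂(volume.restrict (Ioi (0 : ℝ))), ‖a t‖ ≤ 1) (hz : 0 < z.im) :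
    weylLimit T z = {schur T z} := by
  apply weylLimit_eq_singleton_schur
  have hne : (⋂ n : ℕ, weylDisk (T z n)).Nonempty := by
    refine IsCompact.nonempty_iInter_of_sequence_nonempty_isCompact_isClosed
      (fun n : ℕ => weylDisk (T z n)) (fun n => ?_) (fun n => ?_) ?_ fun n => isClosed_weylDisk _
    · exact hT.weylDisk_anti ha hz.le n.cast_nonneg (by push_cast; linarith)
    · exact hT.weylDisk_nonempty ha hz.le n.cast_nonneg
    · rw [Nat.cast_zero, hT.weylDisk_zero]
      exact isCompact_closedBall 0 1
  obtain ⟨w, hw⟩ := hne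
  have hmem : w ∈ weylLimit T z := by
    refine mem_iInter₂.2 fun t ht => ?_
    obtain ⟨n, hn⟩ := exists_nat_ge t
    exact hT.weylDisk_anti ha hz.le (mem_Ioi.1 ht).le hn (mem_iInter.1 hw n)
  refine ⟨w, eq_singleton_iff_unique_mem.2 ⟨hmem, fun w' hw' => ?_⟩⟩
  have h := (hT.isRowSolution z w).det_eq_zero (hT.isRowSolution z w') ha hz
    (fun t ht => hT.mem_weylLimit ha hz.le hmem ht)
    (fun t ht => hT.mem_weylLimit ha hz.le hw' ht)
  simp [hT.zero] at h
  exact (sub_eq_zero.1 h).symm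

/-- The Schur function has a nontangential limit at infinity when `0` is a right Lebesgue point
of the parameter. -/
theorem hasNontangentialLimitAtInfty_schur (hT : IsLebesgueTransferMatrix a T)
    (ha : ∀ᵐ t ∂(volume.restrict (Ioi (0 : ℝ))), ‖a t‖ ≤ 1) {b w : ℂ}
    (hw : Complex.normSq w ≤ 1) (hb : b * (1 + Complex.normSq w) = 2 * w)
    {g : ℝ → ℝ} (hg : HasACDeriv g fun t => ‖a t - b‖) (hg0 : g 0 = 0)
    (hlim : Tendsto (fun t => g t / t) (𝓝[>] 0) (𝓝 0)) :
    HasNontangentialLimitAtInfty (schur T) w := by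
  intro δ hδ
  rcases lt_or_ge (Real.pi / 2) δ with hδ2 | hδ2
  · have : {z : ℂ | z.arg ∈ Icc δ (Real.pi - δ)} = ∅ := by
      ext z
      simp only [mem_ofPred_eq, mem_Icc, mem_empty_iff_false, iff_false, not_and, not_le]
      intro h; linarith
    rw [this]; simp
  have hsin : 0 < Real.sin δ := Real.sin_pos_of_pos_of_lt_pi hδ (by linarith [Real.pi_pos])
  rw [Metric.tendsto_nhds]
  intro ε hε
  set c := Real.sin δ with hc
  -- The length τ = t/|z| is used, and Im z · τ ≥ ct in the sector. Fixing t now makes the leading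
  -- term 1/(Im z · τ) small, independently of z.
  obtain ⟨t, ht, htc⟩ : ∃ t : ℝ, 0 < t ∧ 1 / (c * t) ≤ ε ^ 2 / 2 := by
    refine ⟨2 / (c * ε ^ 2), by positivity, le_of_eq ?_⟩
    field_simp
  -- Because |z|τ = t, the growth bound for N on [0, τ] does not depend on z.
  set m : ℝ := 2 * Real.exp (6 * t) with hm
  have hF : Tendsto (fun τ : ℝ => (2 * m + 4 * m * t) * (g τ / τ) + 4 * m * τ) (𝓝[>] 0)
      (𝓝 0) := by
    have h1 : Tendsto (fun τ : ℝ => τ) (𝓝[>] 0) (𝓝 0) := tendsto_id.mono_left nhdsWithin_le_nhds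
    simpa using (hlim.const_mul (2 * m + 4 * m * t)).add (h1.const_mul (4 * m))
  have hτ : Tendsto (fun z : ℂ => t / ‖z‖) (Bornology.cobounded ℂ) (𝓝[>] 0) := by
    refine tendsto_nhdsWithin_iff.2 ⟨tendsto_norm_cobounded_atTop.const_div_atTop t, ?_⟩
    filter_upwards [tendsto_norm_cobounded_atTop.eventually_gt_atTop 0] with z hz
    exact div_pos ht hz
  have hFz := (hF.comp hτ).eventually (gt_mem_nhds (show (0 : ℝ) < ε ^ 2 / 2 by positivity))
  refine eventually_inf_principal.2 ?_
  filter_upwards [hFz, tendsto_norm_cobounded_atTop.eventually_ge_atTop 1] with z hz hz1 harg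
  have hz0 : 0 < ‖z‖ := by linarith
  have him : c * ‖z‖ ≤ z.im := by
    have h1 : c ≤ Real.sin z.arg := by
      rcases le_total z.arg (Real.pi / 2) with h | h
      · exact Real.sin_le_sin_of_le_of_le_pi_div_two (by linarith) h harg.1
      · rw [← Real.sin_pi_sub z.arg]
        exact Real.sin_le_sin_of_le_of_le_pi_div_two (by linarith) (by linarith)
          (by linarith [harg.2])
    rw [← Complex.norm_mul_sin_arg z, mul_comm]
    exact mul_le_mul_of_nonneg_left h1 hz0.le
  have him0 : 0 < z.im := lt_of_lt_of_le (by positivity) him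
  have hmem : schur T z ∈ weylLimit T z := by
    rw [hT.weylLimit_eq ha him0]; exact mem_singleton _
  set τ : ℝ := t / ‖z‖ with hτd
  have hτ0 : 0 < τ := div_pos ht hz0
  have hzτ : ‖z‖ * τ = t := by rw [hτd]; field_simp
  have key := (hT.isRowSolution z (schur T z)).im_mul_normSq_sub_le ha him0.le hz1 hw hb hg hg0
    (by simp [hT.zero]) hτ0.le (hT.mem_weylLimit ha him0.le hmem hτ0.le)
  rw [mul_assoc 6, hzτ, ← hm] at key
  simp only [hT.zero, Matrix.one_apply_eq, mul_one, Matrix.one_apply_ne (one_ne_zero (α := Fin 2)),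
    add_zero] at key
  set q : ℝ := g τ / τ with hq
  have hgq : g τ = q * τ := by rw [hq]; field_simp
  have hyτ : c * t ≤ z.im * τ := by
    rw [← hzτ, ← mul_assoc]
    exact mul_le_mul_of_nonneg_right him hτ0.le
  have hyτ0 : 0 < z.im * τ := mul_pos him0 hτ0
  have h1 : Complex.normSq (schur T z - w) ≤ 1 / (z.im * τ) +
      ((2 * m + 4 * m * t) * q + 4 * m * τ) := by
    rw [← mul_le_mul_iff_right₀ hyτ0]
    refine key.trans (le_of_eq ?_)
    rw [hgq, mul_add (z.im * τ), mul_one_div_cancel hyτ0.ne', ← hzτ]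
    ring
  have h2 : 1 / (z.im * τ) ≤ 1 / (c * t) := one_div_le_one_div_of_le (by positivity) hyτ
  have h3 : (2 * m + 4 * m * t) * q + 4 * m * τ < ε ^ 2 / 2 := hz
  rw [dist_eq_norm]
  refine lt_of_pow_lt_pow_left₀ 2 hε.le ?_
  rw [← Complex.normSq_eq_norm_sq]
  linarith

end IsLebesgueTransferMatrix

/-! ### Right Lebesgue points -/

theorem hasACDeriv_integral {f : ℝ → ℝ}
    (hf : ∀ R : ℝ, 0 ≤ R → IntervalIntegrable f volume 0 R) :
    HasACDeriv (fun t => ∫ x in (0 : ℝ)..t, f x) f := by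
  have h : HasACDeriv (fun t => ∫ x in (0 : ℝ)..t, (f x : ℂ)) (fun t => (f t : ℂ)) :=
    HasACDeriv.of_eqOn_integral (c := 0) (fun R hR => ⟨(hf R hR).1.ofReal, (hf R hR).2.ofReal⟩)
      fun R _ => (zero_add _).symm
  simpa only [intervalIntegral.integral_ofReal, Complex.ofReal_re] using h.re

/-- Almost every point of the half-line is a right Lebesgue point of a bounded function. -/
theorem ae_isRightLebesguePoint {a : ℝ → ℂ}
    (hm : AEStronglyMeasurable a (volume.restrict (Ioi (0 : ℝ))))
    (ha : ∀ᵐ t ∂(volume.restrict (Ioi (0 : ℝ))), ‖a t‖ ≤ 1) :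
    ∀ᵐ s ∂(volume.restrict (Ioi (0 : ℝ))), ∃ g : ℝ → ℝ,
      HasACDeriv g (fun t => ‖a (t + s) - a s‖) ∧ g 0 = 0 ∧
        Tendsto (fun t => g t / t) (𝓝[>] 0) (𝓝 0) := by
  set f : ℝ → ℂ := (Ioi (0 : ℝ)).indicator a with hf
  have hfm : AEStronglyMeasurable f volume :=
    (aestronglyMeasurable_indicator_iff measurableSet_Ioi).2 hm
  have hfb : ∀ᵐ t, ‖f t‖ ≤ 1 := by
    rw [ae_restrict_iff' measurableSet_Ioi] at ha
    filter_upwards [ha] with t ht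
    by_cases h : t ∈ Ioi (0 : ℝ)
    · rw [hf, indicator_of_mem h]; exact ht h
    · rw [hf, indicator_of_notMem h]; simp
  have hfi : LocallyIntegrable f volume := locallyIntegrable_iff.2 fun k hk =>
    Measure.integrableOn_of_bounded hk.measure_lt_top.ne hfm (ae_restrict_of_ae hfb)
  -- This Vitali family contains the one-sided intervals [s, s + t], which need not be centred at s.
  have h1 := (IsUnifLocDoublingMeasure.vitaliFamily (volume : Measure ℝ)
    1).ae_tendsto_average_norm_sub hfi
  filter_upwards [ae_restrict_of_ae h1, ae_restrict_mem measurableSet_Ioi] with s hs hs0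
  have hs0' : (0 : ℝ) < s := hs0
  have hfs : f s = a s := indicator_of_mem hs0 a
  have hshift : ∀ t : ℝ, 0 ≤ t → f (t + s) = a (t + s) := fun t ht =>
    indicator_of_mem (show t + s ∈ Ioi (0 : ℝ) by simp only [mem_Ioi]; linarith) a
  have hint0 : ∀ x y, IntervalIntegrable (fun t => ‖f t - a s‖) volume x y := fun x y =>
    (((hfi.integrableOn_isCompact isCompact_uIcc).intervalIntegrable).sub
      intervalIntegrable_const).norm
  have hint : ∀ R : ℝ, 0 ≤ R → IntervalIntegrable (fun t => ‖a (t + s) - a s‖) volume 0 R := by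
    intro R hR
    have h2 := (hint0 (0 + s) (R + s)).comp_add_right s
    simp only [add_sub_cancel_right] at h2
    refine h2.congr ?_
    intro t ht
    rw [uIoc_of_le hR] at ht
    simp only [hshift t ht.1.le]
  refine ⟨_, hasACDeriv_integral hint, intervalIntegral.integral_same, ?_⟩
  have h3 : Tendsto (fun t : ℝ => t + s) (𝓝[>] 0) (𝓝[>] s) := by
    refine tendsto_nhdsWithin_iff.2 ⟨?_, ?_⟩
    · have : Tendsto (fun t : ℝ => t + s) (𝓝 0) (𝓝 (0 + s)) := by
        exact (continuous_id.add continuous_const).tendsto 0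
      rw [zero_add] at this
      exact this.mono_left nhdsWithin_le_nhds
    · filter_upwards [self_mem_nhdsWithin] with t ht
      simp only [mem_Ioi] at *; linarith
  refine ((hs.comp (Real.tendsto_Icc_vitaliFamily_right s)).comp h3).congr' ?_
  filter_upwards [self_mem_nhdsWithin] with t ht
  have ht0 : (0 : ℝ) < t := ht
  have e1 : ∫ x in (0 : ℝ)..t, ‖a (x + s) - a s‖ = ∫ x in (0 : ℝ)..t, ‖f (x + s) - a s‖ := by
    refine intervalIntegral.integral_congr fun x hx => ?_
    rw [uIcc_of_le ht0.le] at hx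
    simp only [hshift x hx.1]
  rw [e1, intervalIntegral.integral_comp_add_right (fun x => ‖f x - a s‖) s, zero_add]
  simp only [Function.comp_apply]
  rw [setAverage_eq, integral_Icc_eq_integral_Ioc,
    ← intervalIntegral.integral_of_le (by linarith), hfs, measureReal_def, Real.volume_Icc,
    add_sub_cancel_right, ENNReal.toReal_ofReal ht0.le, smul_eq_mul, inv_mul_eq_div]

/-! ### Reparametrization to Lebesgue measure -/

/-- The distribution function of an atomless measure of infinite mass on the half-line that charges
all intervals is a homeomorphism, under which the measure becomes Lebesgue measure. -/
theorem exists_orderIso_measurePreserving {μ : Measure ℝ} [IsLocallyFiniteMeasure μ]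
    [NullSingletonClass μ] (hlp : Tendsto (fun ℓ : ℝ => μ (Ico 0 ℓ)) atTop (𝓝 ⊤))
    (hpos : ∀ ℓ₁ ℓ₂ : ℝ, 0 ≤ ℓ₁ → ℓ₁ < ℓ₂ → 0 < μ (Ioo ℓ₁ ℓ₂)) :
    ∃ e : ℝ ≃o ℝ, e 0 = 0 ∧
      MeasurePreserving e (μ.restrict (Ioi 0)) (volume.restrict (Ioi 0)) := by
  have hfin : ∀ x y : ℝ, μ (Ioc x y) ≠ ⊤ := fun x y =>
    ((measure_mono Ioc_subset_Icc_self).trans_lt isCompact_Icc.measure_lt_top).ne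
  -- The identity on the negative axis extends the distribution function to a bijection of the whole
  -- line.
  set F : ℝ → ℝ := fun x => (∫ _ in (0 : ℝ)..max x 0, (1 : ℝ) ∂μ) + min x 0 with hF
  have hFcont : Continuous F := by
    have h1 : Continuous fun b : ℝ => ∫ _ in (0 : ℝ)..b, (1 : ℝ) ∂μ :=
      intervalIntegral.continuous_primitive (fun _ _ => intervalIntegrable_const) 0
    exact (h1.comp (continuous_id.max continuous_const)).add (continuous_id.min continuous_const)
  have hF_nonneg : ∀ x, 0 ≤ x → F x = μ.real (Ioc 0 x) := by
    intro x hx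
    simp [hF, max_eq_left hx, min_eq_right hx, intervalIntegral.integral_of_le hx]
  have hF_nonpos : ∀ x, x ≤ 0 → F x = x := by
    intro x hx
    simp [hF, max_eq_right hx, min_eq_left hx]
  have hF0 : F 0 = 0 := hF_nonpos 0 le_rfl
  have hF_sub : ∀ x y, 0 ≤ x → x ≤ y → μ.real (Ioc x y) = F y - F x := by
    intro x y hx hxy
    rw [hF_nonneg x hx, hF_nonneg y (hx.trans hxy), ← Ioc_union_Ioc_eq_Ioc hx hxy,
      measureReal_union (Ioc_disjoint_Ioc_of_le le_rfl) measurableSet_Ioc (hfin _ _) (hfin _ _)]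
    ring
  have hmono0 : ∀ x y, 0 ≤ x → x < y → F x < F y := by
    intro x y hx hxy
    have h1 : 0 < μ.real (Ioc x y) := ENNReal.toReal_pos
      ((hpos x y hx hxy).trans_le (measure_mono Ioo_subset_Ioc_self)).ne' (hfin _ _)
    rw [hF_sub x y hx hxy.le] at h1
    linarith
  have hmono : StrictMono F := by
    intro x y hxy
    rcases le_total 0 x with hx | hx
    · exact hmono0 x y hx hxy
    rcases le_total y 0 with hy | hy
    · rwa [hF_nonpos x hx, hF_nonpos y hy]
    · rcases hx.eq_or_lt with rfl | hx'
      · exact hmono0 0 y le_rfl hxy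
      · rw [hF_nonpos x hx, hF_nonneg y hy]
        exact lt_of_lt_of_le hx' measureReal_nonneg
  have htop : Tendsto F atTop atTop := by
    refine tendsto_atTop.2 fun C => ?_
    have h1 := hlp.eventually (lt_mem_nhds (ENNReal.ofReal_lt_top (r := C)))
    filter_upwards [h1, eventually_ge_atTop 0] with x hx hx0
    rw [hF_nonneg x hx0, measureReal_def, ← ENNReal.ofReal_le_iff_le_toReal (hfin _ _),
      ← measure_congr (Ico_ae_eq_Ioc (μ := μ))]
    exact hx.le
  have hbot : Tendsto F atBot atBot := by
    refine tendsto_id.congr' ?_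
    filter_upwards [eventually_le_atBot 0] with x hx using (hF_nonpos x hx).symm
  set e : ℝ ≃o ℝ := hmono.orderIsoOfSurjective F (hFcont.surjective htop hbot) with he
  have heF : ∀ x, e x = F x := fun x => rfl
  refine ⟨e, hF0, hFcont.measurable, ?_⟩
  symm
  refine Measure.ext_of_Ioc _ _ fun a b hab => ?_
  have hpre : e ⁻¹' Ioc a b = Ioc (e.symm a) (e.symm b) := by
    ext x
    simp only [mem_preimage, mem_Ioc, OrderIso.symm_apply_lt, OrderIso.le_symm_apply]
  have hmax : F (max (e.symm a) 0) = max a 0 := by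
    rw [hmono.monotone.map_max, hF0, ← heF, OrderIso.apply_symm_apply]
  rw [Measure.map_apply (show Measurable e from hFcont.measurable) measurableSet_Ioc, hpre,
    Measure.restrict_apply measurableSet_Ioc, Measure.restrict_apply measurableSet_Ioc,
    Ioc_inter_Ioi, Ioc_inter_Ioi, Real.volume_Ioc]
  have heb : F (e.symm b) = b := e.apply_symm_apply b
  rcases le_total (max (e.symm a) 0) (e.symm b) with h | h
  · have h1 := hF_sub _ _ (le_max_right (e.symm a) 0) h
    rw [hmax, heb] at h1
    rw [← h1, measureReal_def, ENNReal.ofReal_toReal (hfin _ _)]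
  · have h1 := hmono.monotone h
    rw [hmax, heb] at h1
    rw [Ioc_eq_empty (not_lt.2 h), measure_empty, ENNReal.ofReal_of_nonpos (by linarith)]

section ChangeOfVariables

variable {μ : Measure ℝ} {e : ℝ ≃o ℝ}

theorem measurePreserving_symm (he : MeasurePreserving e (μ.restrict (Ioi 0))
    (volume.restrict (Ioi 0))) :
    MeasurePreserving e.symm (volume.restrict (Ioi 0)) (μ.restrict (Ioi 0)) :=
  MeasurePreserving.symm e.toHomeomorph.toMeasurableEquiv he

theorem measurePreserving_symm_Ioc (he0 : e 0 = 0)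
    (he : MeasurePreserving e (μ.restrict (Ioi 0)) (volume.restrict (Ioi 0))) (R : ℝ) :
    MeasurePreserving e.symm (volume.restrict (Ioc 0 R)) (μ.restrict (Ioc 0 (e.symm R))) := by
  have h := (measurePreserving_symm he).restrict_preimage_emb
    e.symm.toHomeomorph.measurableEmbedding (Ioc 0 (e.symm R))
  have hpre : e.symm ⁻¹' Ioc 0 (e.symm R) = Ioc 0 R := by
    ext x
    simp only [mem_preimage, mem_Ioc, OrderIso.lt_symm_apply, he0, OrderIso.le_iff_le]
  rwa [hpre, Measure.restrict_restrict measurableSet_Ioc,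
    Measure.restrict_restrict measurableSet_Ioc, inter_eq_left.2 Ioc_subset_Ioi_self,
    inter_eq_left.2 Ioc_subset_Ioi_self] at h

theorem intervalIntegrable_comp_symm (he0 : e 0 = 0)
    (he : MeasurePreserving e (μ.restrict (Ioi 0)) (volume.restrict (Ioi 0))) {f : ℝ → ℂ} {R : ℝ}
    (hR : 0 ≤ R) (hf : IntervalIntegrable f μ 0 (e.symm R)) :
    IntervalIntegrable (fun t => f (e.symm t)) volume 0 R := by
  have hR' : 0 ≤ e.symm R := by rwa [OrderIso.le_symm_apply, he0]
  rw [intervalIntegrable_iff_integrableOn_Ioc_of_le hR'] at hf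
  rw [intervalIntegrable_iff_integrableOn_Ioc_of_le hR]
  exact ((measurePreserving_symm_Ioc he0 he R).integrable_comp_emb
    e.symm.toHomeomorph.measurableEmbedding).2 hf

theorem integral_comp_symm (he0 : e 0 = 0)
    (he : MeasurePreserving e (μ.restrict (Ioi 0)) (volume.restrict (Ioi 0))) (f : ℝ → ℂ) {R : ℝ}
    (hR : 0 ≤ R) : ∫ t in (0 : ℝ)..R, f (e.symm t) = ∫ l in (0 : ℝ)..e.symm R, f l ∂μ := by
  have hR' : 0 ≤ e.symm R := by rwa [OrderIso.le_symm_apply, he0]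
  rw [intervalIntegral.integral_of_le hR, intervalIntegral.integral_of_le hR']
  exact (measurePreserving_symm_Ioc he0 he R).integral_comp
    e.symm.toHomeomorph.measurableEmbedding f

theorem IsTransferMatrix.comp_symm {𝔞 : ℝ → ℂ} {𝔄 : ℂ → ℝ → Matrix (Fin 2) (Fin 2) ℂ}
    (h : IsTransferMatrix μ 𝔞 𝔄) (he0 : e 0 = 0)
    (he : MeasurePreserving e (μ.restrict (Ioi 0)) (volume.restrict (Ioi 0))) :
    IsLebesgueTransferMatrix (fun t => 𝔞 (e.symm t)) (fun z t => 𝔄 z (e.symm t)) := by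
  have hs0 : e.symm 0 = 0 := by rw [OrderIso.symm_apply_eq, he0]
  -- Right multiplication by j only flips the sign of the first column, which explains the sign in
  -- the first component of a row solution.
  have hl : ∀ z ℓ p, (𝔄 z ℓ * j) p 0 = -𝔄 z ℓ p 0 := by
    intro z ℓ p; simp [j, Matrix.mul_apply, Fin.sum_univ_two]
  have hr : ∀ z ℓ p, (𝔄 z ℓ * j) p 1 = 𝔄 z ℓ p 1 := by
    intro z ℓ p; simp [j, Matrix.mul_apply, Fin.sum_univ_two]
  constructor
  · intro z
    have h0 : ∀ p q, (𝔄 z 0 * j) p q = j p q := fun p q => by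
      simpa using (h z 0 le_rfl p q).2
    simp only [hs0]
    ext p q
    have h1 := h0 p 0
    have h2 := h0 p 1
    rw [hl] at h1
    rw [hr] at h2
    rw [neg_eq_iff_eq_neg] at h1
    fin_cases p <;> fin_cases q <;> simp_all [j]
  · intro z p
    have hsol : ∀ q (R : ℝ), 0 ≤ R →
        IntervalIntegrable (fun t => integrand 𝔞 𝔄 z (e.symm t) p q) volume 0 R ∧
        (𝔄 z (e.symm R) * j) p q = j p q +
          ∫ t in (0 : ℝ)..R, integrand 𝔞 𝔄 z (e.symm t) p q := by
      intro q R hR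
      have h1 := h z (e.symm R) (by rwa [OrderIso.le_symm_apply, he0]) p q
      exact ⟨intervalIntegrable_comp_symm he0 he hR h1.1, by
        rw [h1.2, integral_comp_symm he0 he (fun l => integrand 𝔞 𝔄 z l p q) hR]⟩
    constructor
    · have h1 : HasACDeriv (fun t => 𝔄 z (e.symm t) p 0)
          (fun t => -integrand 𝔞 𝔄 z (e.symm t) p 0) :=
        HasACDeriv.of_eqOn_integral (c := -j p 0) (fun R hR => (hsol 0 R hR).1.neg)
          fun R hR => by
            have h2 := (hsol 0 R hR).2
            rw [hl, neg_eq_iff_eq_neg] at h2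
            rw [h2, intervalIntegral.integral_neg]; ring
      refine h1.congr_deriv (Eventually.of_forall fun t => ?_)
      simp [integrand, coeffA, coeffB, Matrix.mul_apply, Fin.sum_univ_two]
      ring
    · have h1 : HasACDeriv (fun t => 𝔄 z (e.symm t) p 1)
          (fun t => integrand 𝔞 𝔄 z (e.symm t) p 1) :=
        HasACDeriv.of_eqOn_integral (c := j p 1) (fun R hR => (hsol 1 R hR).1)
          fun R hR => by
            have h2 := (hsol 1 R hR).2
            rwa [hr] at h2
      refine h1.congr_deriv (Eventually.of_forall fun t => ?_)
      simp [integrand, coeffA, coeffB, Matrix.mul_apply, Fin.sum_univ_two]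
      ring

/-- The map l ↦ e(l + ℓ) - e(ℓ) is a bijection of (0, ∞), so both intersections run over the same
disks. -/
theorem weylLimit_strip_comp_symm (e : ℝ ≃o ℝ) (𝔄 : ℂ → ℝ → Matrix (Fin 2) (Fin 2) ℂ) (z : ℂ)
    (ℓ : ℝ) :
    weylLimit (strip (fun z t => 𝔄 z (e.symm t)) (e ℓ)) z = weylLimit (strip 𝔄 ℓ) z := by
  ext w
  simp only [weylLimit, mem_iInter₂, strip, OrderIso.symm_apply_apply, mem_Ioi]
  constructor
  · intro h l hl
    have := h (e (l + ℓ) - e ℓ) (sub_pos.2 (e.strictMono (by linarith)))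
    simpa using this
  · intro h t ht
    have := h (e.symm (t + e ℓ) - ℓ) (by
      rw [sub_pos, OrderIso.lt_symm_apply]; linarith)
    simpa using this

theorem schur_strip_comp_symm (e : ℝ ≃o ℝ) (𝔄 : ℂ → ℝ → Matrix (Fin 2) (Fin 2) ℂ) (z : ℂ)
    (ℓ : ℝ) :
    schur (strip (fun z t => 𝔄 z (e.symm t)) (e ℓ)) z = schurFlow 𝔄 z ℓ := by
  simp only [schurFlow, schur, weylLimit_strip_comp_symm]

end ChangeOfVariables

/-! ### Algebra of the boundary value and uniqueness of limits -/

theorem normSq_div_one_add_sqrt {b : ℂ} (hb : ‖b‖ ≤ 1) :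
    Complex.normSq (b / (1 + (Real.sqrt (1 - ‖b‖ ^ 2) : ℂ))) =
      (1 - Real.sqrt (1 - ‖b‖ ^ 2)) / (1 + Real.sqrt (1 - ‖b‖ ^ 2)) := by
  have h1 : 0 ≤ 1 - ‖b‖ ^ 2 := sub_nonneg.2 (pow_le_one₀ (norm_nonneg b) hb)
  have h2 := Real.sq_sqrt h1
  have h3 := Real.sqrt_nonneg (1 - ‖b‖ ^ 2)
  set r := Real.sqrt (1 - ‖b‖ ^ 2)
  have h4 : (0 : ℝ) < 1 + r := by linarith
  have h5 : (1 + (r : ℂ)) = ((1 + r : ℝ) : ℂ) := by push_cast; rfl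
  rw [h5, map_div₀, Complex.normSq_ofReal, Complex.normSq_eq_norm_sq]
  field_simp
  linarith

theorem normSq_div_one_add_sqrt_le_one {b : ℂ} (hb : ‖b‖ ≤ 1) :
    Complex.normSq (b / (1 + (Real.sqrt (1 - ‖b‖ ^ 2) : ℂ))) ≤ 1 := by
  have h3 := Real.sqrt_nonneg (1 - ‖b‖ ^ 2)
  rw [normSq_div_one_add_sqrt hb, div_le_one (by linarith)]
  linarith

/-- Besides |w| ≤ 1, this is all that the comparison argument needs to know about the boundary
value. It is also the inversion formula that recovers the parameter. -/
theorem mul_one_add_normSq_eq {b : ℂ} (hb : ‖b‖ ≤ 1) :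
    b * (1 + Complex.normSq (b / (1 + (Real.sqrt (1 - ‖b‖ ^ 2) : ℂ)))) =
      2 * (b / (1 + (Real.sqrt (1 - ‖b‖ ^ 2) : ℂ))) := by
  have h3 := Real.sqrt_nonneg (1 - ‖b‖ ^ 2)
  rw [normSq_div_one_add_sqrt hb]
  set r := Real.sqrt (1 - ‖b‖ ^ 2)
  have h4 : (1 + (r : ℂ)) ≠ 0 := by
    exact_mod_cast (show (1 + r : ℝ) ≠ 0 by linarith)
  push_cast
  field_simp
  ring

theorem HasNontangentialLimitAtInfty.unique {f : ℂ → ℂ} {c d : ℂ}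
    (hc : HasNontangentialLimitAtInfty f c) (hd : HasNontangentialLimitAtInfty f d) : c = d := by
  have hδ : 0 < Real.pi / 2 := by positivity
  -- The sector with δ = π/2 is the positive imaginary axis, which is unbounded, so limits along it
  -- are unique.
  have hne : (Bornology.cobounded ℂ ⊓
      𝓟 {z : ℂ | z.arg ∈ Icc (Real.pi / 2) (Real.pi - Real.pi / 2)}).NeBot := by
    have h1 : Tendsto (fun r : ℝ => (r : ℂ) * Complex.I) atTop (Bornology.cobounded ℂ) := by
      rw [← tendsto_norm_atTop_iff_cobounded]
      refine tendsto_id.congr' ?_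
      filter_upwards [eventually_ge_atTop 0] with r hr
      simp [abs_of_nonneg hr]
    have h2 : Tendsto (fun r : ℝ => (r : ℂ) * Complex.I) atTop (Bornology.cobounded ℂ ⊓
        𝓟 {z : ℂ | z.arg ∈ Icc (Real.pi / 2) (Real.pi - Real.pi / 2)}) := by
      refine tendsto_inf.2 ⟨h1, tendsto_principal.2 ?_⟩
      filter_upwards [eventually_gt_atTop 0] with r hr
      rw [Complex.arg_real_mul _ hr, Complex.arg_I]
      constructor <;> linarith
    exact h2.neBot
  exact tendsto_nhds_unique (hc _ hδ) (hd _ hδ)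

end ArovGauge

/-! ### The main theorem -/

theorem proposition1p5 (μ : Measure ℝ) (𝔞 : ℝ → ℂ) (𝔄 : ℂ → ℝ → Matrix (Fin 2) (Fin 2) ℂ)
    (hpar : ArovGauge.IsParameters μ 𝔞)
    (hlp : Tendsto (fun ℓ : ℝ => μ (Ico 0 ℓ)) atTop (𝓝 ⊤))
    (hpos : ∀ ℓ₁ ℓ₂ : ℝ, 0 ≤ ℓ₁ → ℓ₁ < ℓ₂ → 0 < μ (Ioo ℓ₁ ℓ₂))
    (hsol : ArovGauge.IsTransferMatrix μ 𝔞 𝔄) :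
    (∀ ℓ : ℝ, 0 ≤ ℓ → ∀ z : ℂ, 0 < z.im →
      ArovGauge.weylLimit (ArovGauge.strip 𝔄 ℓ) z = {ArovGauge.schurFlow 𝔄 z ℓ}) ∧
    ∀ᵐ ℓ ∂(μ.restrict (Ioi 0)),
      ArovGauge.HasNontangentialLimitAtInfty (fun z => ArovGauge.schurFlow 𝔄 z ℓ)
        (𝔞 ℓ / (1 + (Real.sqrt (1 - ‖𝔞 ℓ‖ ^ 2) : ℂ))) ∧
      ∀ c : ℂ, ArovGauge.HasNontangentialLimitAtInfty (fun z => ArovGauge.schurFlow 𝔄 z ℓ) c →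
        𝔞 ℓ = 2 * c / (1 + (‖c‖ : ℂ) ^ 2) := by
  open ArovGauge in
  have := hpar.locallyFinite
  have := hpar.noAtoms
  obtain ⟨e, he0, he⟩ := exists_orderIso_measurePreserving hlp hpos
  have hT := hsol.comp_symm he0 he
  have hsymm := measurePreserving_symm he
  have ha : ∀ᵐ l ∂(μ.restrict (Ioi 0)), ‖𝔞 l‖ ≤ 1 :=
    ae_restrict_of_ae_restrict_of_subset Ioi_subset_Ici_self hpar.norm_le_one
  have ha' : ∀ᵐ t ∂(volume.restrict (Ioi (0 : ℝ))), ‖𝔞 (e.symm t)‖ ≤ 1 :=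
    hsymm.quasiMeasurePreserving.ae ha
  have hm : AEStronglyMeasurable (fun t => 𝔞 (e.symm t)) (volume.restrict (Ioi (0 : ℝ))) :=
    (hpar.aestronglyMeasurable.mono_measure
      (Measure.restrict_mono_set μ Ioi_subset_Ici_self)).comp_measurePreserving hsymm
  have hshift : ∀ s : ℝ, 0 ≤ s →
      ∀ᵐ t ∂(volume.restrict (Ioi (0 : ℝ))), ‖𝔞 (e.symm (t + s))‖ ≤ 1 := by
    intro s hs
    rw [ae_restrict_iff' measurableSet_Ioi] at ha' ⊢
    filter_upwards [(measurePreserving_add_right (volume : Measure ℝ)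
      s).quasiMeasurePreserving.ae ha'] with t ht ht0
    exact ht (by simp only [mem_Ioi] at *; linarith)
  have hnonneg : ∀ ℓ : ℝ, 0 ≤ ℓ → 0 ≤ e ℓ := by
    intro ℓ hℓ
    rw [← he0]; exact e.monotone hℓ
  constructor
  · intro ℓ hℓ z hz
    have h := (hT.strip (hnonneg ℓ hℓ)).weylLimit_eq (hshift _ (hnonneg ℓ hℓ)) hz
    rwa [weylLimit_strip_comp_symm, schur_strip_comp_symm] at h
  -- Null sets pull back along `e`, so Lebesgue-almost every right Lebesgue point e(ℓ) becomes a
  -- statement for μ-almost every ℓ.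
  · filter_upwards [he.quasiMeasurePreserving.ae (ae_isRightLebesguePoint hm ha'), ha,
      ae_restrict_mem measurableSet_Ioi] with ℓ hℓ hb hℓ0
    obtain ⟨g, hg, hg0, hlim⟩ := hℓ
    rw [OrderIso.symm_apply_apply] at hg
    have h0 := hnonneg ℓ (mem_Ioi.1 hℓ0).le
    have h := (hT.strip h0).hasNontangentialLimitAtInfty_schur (hshift _ h0)
      (normSq_div_one_add_sqrt_le_one hb) (mul_one_add_normSq_eq hb) hg hg0 hlim
    rw [funext fun z => schur_strip_comp_symm e 𝔄 z ℓ] at h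
    refine ⟨h, fun c hc => ?_⟩
    rw [hc.unique h]
    have h1 := mul_one_add_normSq_eq hb
    rw [Complex.normSq_eq_norm_sq] at h1
    push_cast at h1
    rw [← h1, mul_div_cancel_right₀]
    exact_mod_cast (by positivity : (0 : ℝ) < 1 +
      ‖𝔞 ℓ / (1 + (Real.sqrt (1 - ‖𝔞 ℓ‖ ^ 2) : ℂ))‖ ^ 2).ne'
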